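/- Let $(M,\mathcal T)$ be a connected closed triangulated surface, i.e. a connected quotient of a finite nonempty disjoint union of triangles obtained by identifying all their edges in pairs by homeomorphisms, with vertices $V$, $|V|=N$, edges $E$, faces $F$ and $\chi(M)=|V|-|E|+|F|$. Let $\varepsilon:V\to\{0,1\}$ and $\eta:E\to\mathbb R$ satisfy $$\varepsilon_s\varepsilon_t+\eta_{st}>0\quad\forall\,\{st\}\in E,\qquad \varepsilon_q\eta_{st}+\eta_{qs}\eta_{qt}\ge 0\quad\forall\,\{ijk\}\in F,\ \{q,s,t\}=\{i,j,k\}.$$ For $u\in\mathbb R^N$ (a generalized discrete conformal factor) put $l_{ij}=\sqrt{\varepsilon_ie^{2u_i}+\varepsilon_je^{2u_j}+2\eta_{ij}e^{u_i+u_j}}$. For a face $\{ijk\}$, let the extended inner angle $\widetilde\theta_i^{jk}(u)$ be the inner angle at $i$ of the Euclidean triangle with side lengths $l_{ij},l_{ik},l_{jk}$ if these are positive and satisfy the strict triangle inequalities; otherwise let it be $\pi$ if $l_{jk}\ge l_{ij}+l_{ik}$, and $0$ if not. Let $\widetilde K_i(u)=2\pi-\sum\widetilde\theta_i^{jk}(u)$,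 the sum running over all corners of faces located at the vertex $i$. Let $\overline K:V\to(-\infty,2\pi)$ satisfy $\sum_{i\in V}\overline K_i=2\pi\chi(M)$. Then for every $u_0\in\mathbb R^N$ the extended modified Euclidean combinatorial Ricci flow $$\frac{du_i}{dt}=\overline K_i-\widetilde K_i(u),\qquad i\in V,\qquad u(0)=u_0,$$ has a solution on $[0,\infty)$, and it is unique: for every interval $J\subseteq[0,\infty)$ containing $0$, any two solutions on $J$ with initial value $u_0$ are equal on $J$. -/

import Mathlib

namespace RicciFlow

/-- An oriented side `a → b` of one of the triangles `σ ∈ F`; the corners of every triangle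
are labelled by `Fin 3`. -/
abbrev Dart (F : Type*) : Type _ := {p : F × Fin 3 × Fin 3 // p.2.1 ≠ p.2.2}

/-- The side of the triangle `σ` oriented from its corner `a` to its corner `b`. -/
def side {F : Type*} (σ : F) (a b : Fin 3) (h : a ≠ b) : Dart F := ⟨(σ, a, b), h⟩

namespace Dart

variable {F : Type*}

def face (d : Dart F) : F := d.1.1

/-- The corner from which an oriented side starts. -/
def tail (d : Dart F) : F × Fin 3 := (d.1.1, d.1.2.1)

/-- The corner at which an oriented side ends. -/
def head (d : Dart F) : F × Fin 3 := (d.1.1, d.1.2.2)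

/-- The same side with the opposite orientation. -/
def rev (d : Dart F) : Dart F := ⟨(d.1.1, d.1.2.2, d.1.2.1), d.2.symm⟩

end Dart

/-- A connected closed triangulated surface, presented as the quotient of a finite nonempty
disjoint union `F` of triangles by identifying all their sides in pairs.  The side underlying `d` is
glued to the side underlying `glue d`, the tail (head) of `d` going to the tail (head) of `glue d`.
Sides of one and the same triangle may be glued to each other, and the corners of a triangle may
become equal in the quotient, so this is not restricted to simplicial complexes; orientability is
not required. -/
structure TriangulatedSurface (F : Type*) [Fintype F] where
  glue : Dart F → Dart F
  glue_glue : ∀ d, glue (glue d) = d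
  /-- the identification of two sides does not depend on the orientation used to describe it -/
  glue_rev : ∀ d, glue d.rev = (glue d).rev
  /-- no side is glued to itself -/
  glue_ne : ∀ d, glue d ≠ d
  glue_ne_rev : ∀ d, glue d ≠ d.rev
  nonempty : Nonempty F
  /-- any two triangles are joined by a chain of triangles glued along sides -/
  connected : ∀ σ τ : F,
    Relation.ReflTransGen (fun a b => ∃ d : Dart F, d.face = a ∧ (glue d).face = b) σ τ

namespace TriangulatedSurface

variable {F : Type*} [Fintype F] (S : TriangulatedSurface F)

/-- The vertices: corners of triangles modulo the identifications induced by the gluing.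
(The heads are covered by applying this to reversed sides.) -/
def Vertex : Type _ :=
  Quot (fun c c' : F × Fin 3 => ∃ d : Dart F, d.tail = c ∧ (S.glue d).tail = c')

/-- The unoriented edges: oriented sides modulo orientation reversal and gluing. -/
def Edge : Type _ :=
  Quot (fun d d' : Dart F => d' = d.rev ∨ d' = S.glue d)

/-- The vertex at a corner of a triangle. -/
def vertex (c : F × Fin 3) : S.Vertex := Quot.mk _ c

/-- The edge underlying an oriented side of a triangle. -/
def edge (d : Dart F) : S.Edge := Quot.mk _ d

instance : Finite S.Vertex := by unfold Vertex; infer_instance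

instance : Finite S.Edge := by unfold Edge; infer_instance

noncomputable instance : Fintype S.Vertex := Fintype.ofFinite _

/-- The Euler characteristic `|V| - |E| + |F|`. -/
noncomputable def eulerChar : ℤ :=
  (Nat.card S.Vertex : ℤ) - (Nat.card S.Edge : ℤ) + (Fintype.card F : ℤ)

/-- `ε_s ε_t + η_{st} > 0` for every edge `{st}`. -/
def StructureCondition1 (ε : S.Vertex → ℝ) (η : S.Edge → ℝ) : Prop :=
  ∀ d : Dart F, 0 < ε (S.vertex d.tail) * ε (S.vertex d.head) + η (S.edge d)

/-- `ε_q η_{st} + η_{qs} η_{qt} ≥ 0` for every face and every labelling `q, s, t` of its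
three corners. -/
def StructureCondition2 (ε : S.Vertex → ℝ) (η : S.Edge → ℝ) : Prop :=
  ∀ (σ : F) (q s t : Fin 3) (hqs : q ≠ s) (hqt : q ≠ t) (hst : s ≠ t),
    0 ≤ ε (S.vertex (σ, q)) * η (S.edge (side σ s t hst))
      + η (S.edge (side σ q s hqs)) * η (S.edge (side σ q t hqt))

/-- The Euclidean length
`l_{ij} = √(ε_i e^{2 u_i} + ε_j e^{2 u_j} + 2 η_{ij} e^{u_i + u_j})`. -/
noncomputable def length (ε : S.Vertex → ℝ) (η : S.Edge → ℝ) (u : S.Vertex → ℝ)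
    (d : Dart F) : ℝ :=
  Real.sqrt (ε (S.vertex d.tail) * Real.exp (2 * u (S.vertex d.tail))
    + ε (S.vertex d.head) * Real.exp (2 * u (S.vertex d.head))
    + 2 * η (S.edge d) * Real.exp (u (S.vertex d.tail) + u (S.vertex d.head)))

end TriangulatedSurface

/-- `a, b, c` are the side lengths of a nondegenerate Euclidean triangle. -/
def Nondegenerate (a b c : ℝ) : Prop :=
  0 < a ∧ 0 < b ∧ 0 < c ∧ a < b + c ∧ b < a + c ∧ c < a + b

open Classical in
/-- The extended inner angle opposite to the side of length `a` in a triangle with side lengths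
`a, b, c`: the inner angle (law of cosines) if the triangle is nondegenerate; otherwise `π` if `a`
is the side that is too long, and `0` if it is not. -/
noncomputable def extAngle (a b c : ℝ) : ℝ :=
  if Nondegenerate a b c then Real.arccos ((b ^ 2 + c ^ 2 - a ^ 2) / (2 * b * c))
  else if b + c ≤ a then Real.pi
  else 0

namespace TriangulatedSurface

variable {F : Type*} [Fintype F] (S : TriangulatedSurface F)

/-- The extended inner angle at the corner `c.2` of the triangle `c.1`; the two other corners are
`c.2 + 1` and `c.2 + 2` (modulo 3). -/
noncomputable def cornerAngle (ε : S.Vertex → ℝ) (η : S.Edge → ℝ) (u : S.Vertex → ℝ)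
    (c : F × Fin 3) : ℝ :=
  extAngle
    (S.length ε η u (side c.1 (c.2 + 1) (c.2 + 2) (by simp)))
    (S.length ε η u (side c.1 c.2 (c.2 + 1) (by simp)))
    (S.length ε η u (side c.1 c.2 (c.2 + 2) (by simp)))

open Classical in
/-- The generalized combinatorial curvature: `2π` minus the sum of the extended inner angles at
all corners located at the vertex `i`. -/
noncomputable def extCurvature (ε : S.Vertex → ℝ) (η : S.Edge → ℝ) (u : S.Vertex → ℝ)
    (i : S.Vertex) : ℝ :=
  2 * Real.pi - ∑ c : F × Fin 3, if S.vertex c = i then S.cornerAngle ε η u c else 0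

/-- `u` solves the extended modified Euclidean combinatorial Ricci flow
`du_i/dt = K̄_i - K̃_i(u)` on the time interval `J` (one-sided derivatives at end points that
belong to `J`). -/
def IsSolutionOn (ε : S.Vertex → ℝ) (η : S.Edge → ℝ) (Kbar : S.Vertex → ℝ)
    (J : Set ℝ) (u : ℝ → S.Vertex → ℝ) : Prop :=
  ∀ t ∈ J, ∀ i : S.Vertex,
    HasDerivWithinAt (fun s => u s i) (Kbar i - S.extCurvature ε η (u t) i) J t

end TriangulatedSurface

end RicciFlow

namespace RicciFlow

/-! ### The angles of one triangle -/

/-! The extended curvature is a monotone operator: `∑ (v i - u i) * (K̃ i v - K̃ i u) ≥ 0` for all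
`u`, `v`. The flow field is therefore dissipative, and it is also continuous and bounded.
Dissipativity makes the squared distance between two solutions nonincreasing, which gives
uniqueness. It also makes the solutions for uniformly close `C¹` approximations a Cauchy sequence,
whose limit solves the flow; boundedness excludes blow-up (`exists_integralCurve_Ici`).

Monotonicity is proved face by face. Along a line `u + t w`, let `φ t` be the sum of the angles of a
face weighted by the values of `w` at its corners. Where the triangle is nondegenerate, `φ'` is a
negative multiple of a Laplacian-type quadratic form, and the structure conditions make this form
nonnegative (`angle_variation_nonpos`). Where it is degenerate, `φ` equals `π` times one of the
three weights. So `φ` is continuous and has derivative `≤ 0` off finitely many values, which already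
forces it to be antitone (`antitone_of_hasDerivAt_nonpos_off_finite`). Nothing is needed about the
shape of the set of nondegenerate factors. -/

theorem extAngle_eq_arccos {a b c : ℝ} (ha : 0 < a) (hb : 0 < b) (hc : 0 < c) :
    extAngle a b c = Real.arccos ((b ^ 2 + c ^ 2 - a ^ 2) / (2 * b * c)) := by
  have hbc : 0 < 2 * b * c := by positivity
  unfold extAngle
  -- `Real.arccos` is constant outside `[-1, 1]`, so in the degenerate cases the law of cosines
  -- already returns the prescribed values `π` and `0`.
  split_ifs with h h'
  · rfl
  · symm
    apply Real.arccos_of_le_neg_one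
    rw [div_le_iff₀ hbc]
    nlinarith
  · symm
    apply Real.arccos_of_one_le
    rw [le_div_iff₀ hbc]
    have h2 : a + c ≤ b ∨ a + b ≤ c := by
      by_contra! hcon
      exact h ⟨ha, hb, hc, not_le.mp h', hcon.1, hcon.2⟩
    rcases h2 with h2 | h2 <;> nlinarith

/-- Sixteen times the squared area of a triangle, in terms of its squared side lengths. -/
def heron (A B C : ℝ) : ℝ := 2 * (A * B + B * C + C * A) - A ^ 2 - B ^ 2 - C ^ 2

/-- The weighted sum of the three extended angles of a triangle with squared side lengths
`A, B, C`. -/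
noncomputable def angleSum (x y z A B C : ℝ) : ℝ :=
  x * extAngle (√A) (√B) (√C) + y * extAngle (√B) (√C) (√A) + z * extAngle (√C) (√A) (√B)

theorem extAngle_sqrt {A B C : ℝ} (hA : 0 < A) (hB : 0 < B) (hC : 0 < C) :
    extAngle (√A) (√B) (√C) = Real.arccos ((B + C - A) / (2 * √B * √C)) := by
  rw [extAngle_eq_arccos (Real.sqrt_pos.2 hA) (Real.sqrt_pos.2 hB) (Real.sqrt_pos.2 hC),
    Real.sq_sqrt hA.le, Real.sq_sqrt hB.le, Real.sq_sqrt hC.le]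

theorem extAngle_comm {a b c : ℝ} (ha : 0 < a) (hb : 0 < b) (hc : 0 < c) :
    extAngle a b c = extAngle a c b := by
  rw [extAngle_eq_arccos ha hb hc, extAngle_eq_arccos ha hc hb]
  congr 1
  rw [add_comm (b ^ 2), mul_right_comm]

theorem hasDerivAt_extAngle {A B C : ℝ → ℝ} {A' B' C' t : ℝ}
    (hA : HasDerivAt A A' t) (hB : HasDerivAt B B' t) (hC : HasDerivAt C C' t)
    (hA0 : ∀ t, 0 < A t) (hB0 : ∀ t, 0 < B t) (hC0 : ∀ t, 0 < C t)
    (hD : 0 < heron (A t) (B t) (C t)) :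
    HasDerivAt (fun s => extAngle (√(A s)) (√(B s)) (√(C s)))
      ((A' - B' * (A t + B t - C t) / (2 * B t) - C' * (A t + C t - B t) / (2 * C t))
        / √(heron (A t) (B t) (C t))) t := by
  have hfun : (fun s => extAngle (√(A s)) (√(B s)) (√(C s))) =
      fun s => Real.arccos ((B s + C s - A s) / (2 * √(B s) * √(C s))) :=
    funext fun s => extAngle_sqrt (hA0 s) (hB0 s) (hC0 s)
  rw [hfun]
  have hb := Real.sqrt_pos.2 (hB0 t)
  have hc := Real.sqrt_pos.2 (hC0 t)
  have hd := Real.sqrt_pos.2 hD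
  have hb2 := Real.sq_sqrt (hB0 t).le
  have hc2 := Real.sq_sqrt (hC0 t).le
  have hd2 := Real.sq_sqrt hD.le
  set b := √(B t) with hbdef
  set c := √(C t) with hcdef
  set d := √(heron (A t) (B t) (C t)) with hddef
  have hq := (((hB.add hC).sub hA).div
    (((hB.sqrt (hB0 t).ne').const_mul 2).mul (hC.sqrt (hC0 t).ne'))
    (by simp only [Pi.mul_apply]; positivity))
  -- Heron's formula for the sine of the angle. It is nonzero, so the cosine stays away from `±1`,
  -- where `arccos` is not differentiable.
  have hsq : 1 - ((B t + C t - A t) / (2 * b * c)) ^ 2 = (d / (2 * b * c)) ^ 2 := by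
    field_simp
    rw [hd2, heron, hb2, hc2]
    ring
  have hpos : 0 < (d / (2 * b * c)) ^ 2 := by positivity
  have h1 : (B t + C t - A t) / (2 * b * c) ≠ -1 := by
    intro h; rw [h] at hsq; norm_num at hsq; rw [← hsq] at hpos; simp at hpos
  have h2 : (B t + C t - A t) / (2 * b * c) ≠ 1 := by
    intro h; rw [h] at hsq; norm_num at hsq; rw [← hsq] at hpos; simp at hpos
  have key := (Real.hasDerivAt_arccos h1 h2).comp t hq
  refine key.congr_deriv ?_
  rw [hsq, Real.sqrt_sq (by positivity)]
  simp only [Pi.add_apply, Pi.sub_apply, Pi.mul_apply]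
  rw [← hbdef, ← hcdef, ← hb2, ← hc2]
  field_simp
  ring

theorem heron_pos {a b c : ℝ} (ha : 0 < a) (h1 : a < b + c) (h2 : b < c + a) (h3 : c < a + b) :
    0 < heron (a ^ 2) (b ^ 2) (c ^ 2) := by
  have : heron (a ^ 2) (b ^ 2) (c ^ 2) = (a + b + c) * (b + c - a) * (c + a - b) * (a + b - c) := by
    unfold heron; ring
  rw [this]
  have := sub_pos.2 h1
  have := sub_pos.2 h2
  have := sub_pos.2 h3
  have : 0 < a + b + c := by linarith
  positivity

theorem extAngle_of_le {a b c : ℝ} (h : b + c ≤ a) : extAngle a b c = Real.pi := by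
  unfold extAngle
  rw [if_neg (fun hn => by unfold Nondegenerate at hn; linarith), if_pos h]

theorem extAngle_of_le_left {a b c : ℝ} (hc : 0 < c) (h : c + a ≤ b) : extAngle a b c = 0 := by
  unfold extAngle
  rw [if_neg (fun hn => by unfold Nondegenerate at hn; linarith), if_neg (by linarith)]

theorem extAngle_of_le_right {a b c : ℝ} (hb : 0 < b) (h : a + b ≤ c) : extAngle a b c = 0 := by
  unfold extAngle
  rw [if_neg (fun hn => by unfold Nondegenerate at hn; linarith), if_neg (by linarith)]

/-- In a degenerate triangle one angle is `π` and the other two vanish. -/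
theorem heron_pos_of_angleSum_notMem {A B C x y z : ℝ} (hA : 0 < A) (hB : 0 < B) (hC : 0 < C)
    (h : angleSum x y z A B C ∉ ({x * Real.pi, y * Real.pi, z * Real.pi} : Set ℝ)) :
    0 < heron A B C := by
  have ha := Real.sqrt_pos.2 hA
  have hb := Real.sqrt_pos.2 hB
  have hc := Real.sqrt_pos.2 hC
  by_contra hD
  apply h
  unfold angleSum
  have : √B + √C ≤ √A ∨ √C + √A ≤ √B ∨ √A + √B ≤ √C := by
    by_contra! hcon
    apply hD
    have := heron_pos ha hcon.1 hcon.2.1 hcon.2.2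
    rwa [Real.sq_sqrt hA.le, Real.sq_sqrt hB.le, Real.sq_sqrt hC.le] at this
  rcases this with h | h | h
  · rw [extAngle_of_le h, extAngle_of_le_right hc h, extAngle_of_le_left hb h]; simp
  · rw [extAngle_of_le_left hc h, extAngle_of_le h, extAngle_of_le_right ha h]; simp
  · rw [extAngle_of_le_right hb h, extAngle_of_le_left ha h, extAngle_of_le h]; simp

/-- A quadratic form of Laplacian type on a triangle whose second elementary symmetric function of
the weights is positive is nonnegative as soon as the weighted sum with the squared side lengths
is positive. -/
theorem laplacian_nonneg {W₁ W₂ W₃ A B C x y z : ℝ} (hB : 0 < B) (hA : 0 < A)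
    (hD : 0 < heron A B C) (he : 0 < W₁ * W₂ + W₂ * W₃ + W₃ * W₁)
    (hs : 0 < A * W₁ + B * W₂ + C * W₃) :
    0 ≤ W₁ * (y - z) ^ 2 + W₂ * (z - x) ^ 2 + W₃ * (x - y) ^ 2 := by
  have hpos : 0 < W₁ + W₃ := by
    by_contra! hcon
    have e1 : (A * W₁ + B * W₂ + C * W₃) * (W₁ + W₃) ≤ 0 :=
      mul_nonpos_of_nonneg_of_nonpos hs.le hcon
    have e2 := mul_pos hB he
    -- Expanding the product in `e1` gives this form plus `B` times the symmetric function in `he`.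
    -- The form has discriminant `-heron A B C < 0`, so it cannot be negative.
    have e3 : A * W₁ ^ 2 + C * W₃ ^ 2 + (A + C - B) * (W₁ * W₃) < 0 := by nlinarith
    have e4 : 4 * A * (A * W₁ ^ 2 + C * W₃ ^ 2 + (A + C - B) * (W₁ * W₃)) =
        (2 * A * W₁ + (A + C - B) * W₃) ^ 2 + heron A B C * W₃ ^ 2 := by
      unfold heron; ring
    have e5 : 0 ≤ (2 * A * W₁ + (A + C - B) * W₃) ^ 2 + heron A B C * W₃ ^ 2 := by positivity
    have e6 := mul_neg_of_pos_of_neg (by positivity : 0 < 4 * A) e3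
    linarith
  refine nonneg_of_mul_nonneg_right (a := W₁ + W₃) ?_ hpos
  have : (W₁ + W₃) * (W₁ * (y - z) ^ 2 + W₂ * (z - x) ^ 2 + W₃ * (x - y) ^ 2) =
      ((W₁ + W₃) * (y - z) + W₃ * (z - x)) ^ 2
        + (W₁ * W₂ + W₂ * W₃ + W₃ * W₁) * (z - x) ^ 2 := by ring
  rw [this]
  positivity

/-- The derivative of the weighted angle sum of a generalized circle packing triangle, up to the
positive factor `√(heron A B C)`, in the direction of the weights. -/
theorem angle_variation_nonpos {s₁ s₂ s₃ b₁ b₂ b₃ x y z A B C A' B' C' : ℝ}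
    (h₁ : 0 < s₂ * s₃ + b₁) (h₂ : 0 < s₃ * s₁ + b₂) (h₃ : 0 < s₁ * s₂ + b₃)
    (g₁ : 0 ≤ s₁ ^ 2 * b₁ + b₂ * b₃) (g₂ : 0 ≤ s₂ ^ 2 * b₂ + b₃ * b₁)
    (g₃ : 0 ≤ s₃ ^ 2 * b₃ + b₁ * b₂)
    (hA : A = s₂ ^ 2 + s₃ ^ 2 + 2 * b₁) (hB : B = s₃ ^ 2 + s₁ ^ 2 + 2 * b₂)
    (hC : C = s₁ ^ 2 + s₂ ^ 2 + 2 * b₃)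
    (hA' : A' = 2 * (s₂ ^ 2 * y + s₃ ^ 2 * z + (y + z) * b₁))
    (hB' : B' = 2 * (s₃ ^ 2 * z + s₁ ^ 2 * x + (z + x) * b₂))
    (hC' : C' = 2 * (s₁ ^ 2 * x + s₂ ^ 2 * y + (x + y) * b₃))
    (hD : 0 < heron A B C) :
    x * (A' - B' * (A + B - C) / (2 * B) - C' * (A + C - B) / (2 * C))
      + y * (B' - C' * (B + C - A) / (2 * C) - A' * (B + A - C) / (2 * A))
      + z * (C' - A' * (C + A - B) / (2 * A) - B' * (C + B - A) / (2 * B)) ≤ 0 := by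
  have hA0 : 0 < A := by nlinarith [sq_nonneg (s₂ - s₃)]
  have hB0 : 0 < B := by nlinarith [sq_nonneg (s₃ - s₁)]
  have hC0 : 0 < C := by nlinarith [sq_nonneg (s₁ - s₂)]
  -- The weights of the quadratic form are `N₁ / A`, `N₂ / B`, `N₃ / C`. A single `Nᵢ` may be
  -- negative; only their sum and the second symmetric function of the weights are controlled.
  set N₁ := s₂ ^ 2 * s₃ ^ 2 - b₁ ^ 2 + (s₂ ^ 2 * b₂ + b₃ * b₁) + (s₃ ^ 2 * b₃ + b₁ * b₂) with hN₁
  set N₂ := s₃ ^ 2 * s₁ ^ 2 - b₂ ^ 2 + (s₃ ^ 2 * b₃ + b₁ * b₂) + (s₁ ^ 2 * b₁ + b₂ * b₃) with hN₂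
  set N₃ := s₁ ^ 2 * s₂ ^ 2 - b₃ ^ 2 + (s₁ ^ 2 * b₁ + b₂ * b₃) + (s₂ ^ 2 * b₂ + b₃ * b₁) with hN₃
  have hsum : heron A B C = 4 * (N₁ + N₂ + N₃) := by
    rw [hN₁, hN₂, hN₃, hA, hB, hC, heron]; ring
  have hS : 0 < N₁ + N₂ + N₃ := by linarith
  have hE : 0 < 2 * (s₁ ^ 2 * s₂ ^ 2 * s₃ ^ 2 + b₁ * b₂ * b₃)
      + (s₁ ^ 2 * b₁ + b₂ * b₃) * (s₂ ^ 2 + s₃ ^ 2) + (s₂ ^ 2 * b₂ + b₃ * b₁) * (s₃ ^ 2 + s₁ ^ 2)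
      + (s₃ ^ 2 * b₃ + b₁ * b₂) * (s₁ ^ 2 + s₂ ^ 2) := by
    -- The goal is exactly `2 * e + e1 + e2 + e3`: in the product of the three edge conditions the
    -- mixed terms are `s₂ s₃ (s₁² b₁ + b₂ b₃)` and its cyclic analogues.
    have e := mul_pos (mul_pos h₁ h₂) h₃
    have e1 := mul_nonneg g₁ (sq_nonneg (s₂ - s₃))
    have e2 := mul_nonneg g₂ (sq_nonneg (s₃ - s₁))
    have e3 := mul_nonneg g₃ (sq_nonneg (s₁ - s₂))
    linarith
  have hprod : N₁ * N₂ * C + N₂ * N₃ * A + N₃ * N₁ * B = (N₁ + N₂ + N₃) *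
      (2 * (s₁ ^ 2 * s₂ ^ 2 * s₃ ^ 2 + b₁ * b₂ * b₃)
      + (s₁ ^ 2 * b₁ + b₂ * b₃) * (s₂ ^ 2 + s₃ ^ 2) + (s₂ ^ 2 * b₂ + b₃ * b₁) * (s₃ ^ 2 + s₁ ^ 2)
      + (s₃ ^ 2 * b₃ + b₁ * b₂) * (s₁ ^ 2 + s₂ ^ 2)) := by
    rw [hN₁, hN₂, hN₃, hA, hB, hC]; ring
  have he : 0 < N₁ / A * (N₂ / B) + N₂ / B * (N₃ / C) + N₃ / C * (N₁ / A) := by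
    have : N₁ / A * (N₂ / B) + N₂ / B * (N₃ / C) + N₃ / C * (N₁ / A) =
        (N₁ * N₂ * C + N₂ * N₃ * A + N₃ * N₁ * B) / (A * B * C) := by
      field_simp
    rw [this, hprod]
    positivity
  have hs : 0 < A * (N₁ / A) + B * (N₂ / B) + C * (N₃ / C) := by
    rw [mul_div_cancel₀ _ hA0.ne', mul_div_cancel₀ _ hB0.ne', mul_div_cancel₀ _ hC0.ne']
    exact hS
  have key := laplacian_nonneg (x := x) (y := y) (z := z) hB0 hA0 hD he hs
  have hid : x * (A' - B' * (A + B - C) / (2 * B) - C' * (A + C - B) / (2 * C))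
      + y * (B' - C' * (B + C - A) / (2 * C) - A' * (B + A - C) / (2 * A))
      + z * (C' - A' * (C + A - B) / (2 * A) - B' * (C + B - A) / (2 * B)) =
      -2 * (N₁ / A * (y - z) ^ 2 + N₂ / B * (z - x) ^ 2 + N₃ / C * (x - y) ^ 2) := by
    field_simp
    rw [hN₁, hN₂, hN₃, hA', hB', hC', hA, hB, hC]
    ring
  rw [hid]
  linarith

end RicciFlow

namespace RicciFlow

open scoped NNReal Manifold ContDiff

/-! ### Dissipative vector fields -/

section Dissipative

variable {E : Type*} [NormedAddCommGroup E] [InnerProductSpace ℝ E]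

/-- By continuity the constant `f x` is a valid approximation near `x`; since balls are convex, a
smooth partition of unity glues these local choices. -/
theorem exists_contDiff_norm_sub_lt [FiniteDimensional ℝ E] {f : E → E} (hf : Continuous f)
    {δ : ℝ} (hδ : 0 < δ) : ∃ g : E → E, ContDiff ℝ 1 g ∧ ∀ x, ‖g x - f x‖ < δ := by
  obtain ⟨g, hg⟩ := exists_contMDiffMap_forall_mem_convex_of_local_const (n := 1) 𝓘(ℝ, E)
    (t := fun x => Metric.ball (f x) δ) (fun x => convex_ball _ _) (fun x => by
      refine ⟨f x, ?_⟩
      filter_upwards [hf.continuousAt.eventually (Metric.ball_mem_nhds (f x) hδ)] with y hy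
      simpa [dist_comm] using hy)
  exact ⟨g, contMDiff_iff_contDiff.1 g.contMDiff, fun x => by simpa [dist_eq_norm] using hg x⟩

theorem hasDerivWithinAt_norm_sub_sq {J : Set ℝ} {u v : ℝ → E} {u' v' : E} {t : ℝ}
    (hu : HasDerivWithinAt u u' J t) (hv : HasDerivWithinAt v v' J t) :
    HasDerivWithinAt (fun s => ‖u s - v s‖ ^ 2) (2 * inner ℝ (u t - v t) (u' - v')) J t := by
  simpa using (hu.sub hv).norm_sq

/-- If the squared distance of two curves grows at most at rate `c`, it is at most `c t`. -/
theorem norm_sub_sq_le {u v u' v' : ℝ → E} {c T : ℝ}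
    (hu : ∀ t ∈ Set.Icc 0 T, HasDerivWithinAt u (u' t) (Set.Icc 0 T) t)
    (hv : ∀ t ∈ Set.Icc 0 T, HasDerivWithinAt v (v' t) (Set.Icc 0 T) t)
    (h0 : u 0 = v 0)
    (hc : ∀ t ∈ Set.Icc 0 T, 2 * inner ℝ (u t - v t) (u' t - v' t) ≤ c)
    {t : ℝ} (ht : t ∈ Set.Icc 0 T) : ‖u t - v t‖ ^ 2 ≤ c * t := by
  have hd : ∀ s ∈ Set.Icc 0 T, HasDerivWithinAt (fun s => ‖u s - v s‖ ^ 2 - c * s)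
      (2 * inner ℝ (u s - v s) (u' s - v' s) - c * 1) (Set.Icc 0 T) s := fun s hs =>
    (hasDerivWithinAt_norm_sub_sq (hu s hs) (hv s hs)).sub
      ((hasDerivWithinAt_id s _).const_mul c)
  have hanti := antitoneOn_of_hasDerivWithinAt_nonpos (convex_Icc 0 T)
    (fun s hs => (hd s hs).continuousWithinAt)
    (fun s hs => (hd s (interior_subset hs)).mono interior_subset)
    (fun s hs => by linarith [hc s (interior_subset hs)])
  have := hanti (Set.left_mem_Icc.2 (ht.1.trans ht.2)) ht ht.1
  simp only [h0, sub_self, norm_zero, mul_zero] at this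
  norm_num at this
  linarith

/-- Uniqueness of integral curves of a dissipative vector field. -/
theorem eq_of_dissipative {f : E → E} (hdis : ∀ x y, inner ℝ (x - y) (f x - f y) ≤ 0)
    {u v : ℝ → E} {T : ℝ}
    (hu : ∀ t ∈ Set.Icc 0 T, HasDerivWithinAt u (f (u t)) (Set.Icc 0 T) t)
    (hv : ∀ t ∈ Set.Icc 0 T, HasDerivWithinAt v (f (v t)) (Set.Icc 0 T) t)
    (h0 : u 0 = v 0) {t : ℝ} (ht : t ∈ Set.Icc 0 T) : u t = v t := by
  have := norm_sub_sq_le hu hv h0 (c := 0)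
    (fun s _ => by linarith [hdis (u s) (v s)]) ht
  rw [zero_mul] at this
  have h2 : ‖u t - v t‖ = 0 := by
    have := le_antisymm this (sq_nonneg _)
    simpa using this
  exact sub_eq_zero.1 (norm_eq_zero.1 h2)

/-- A bounded `C¹` vector field has integral curves on every interval `[0, T]`. -/
theorem exists_integralCurve_of_contDiff [FiniteDimensional ℝ E] {g : E → E}
    (hg : ContDiff ℝ 1 g) {L : ℝ≥0} (hL : ∀ x, ‖g x‖ ≤ L) (x₀ : E) (T : ℝ≥0) :
    ∃ u : ℝ → E, u 0 = x₀ ∧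
      ∀ t ∈ Set.Icc 0 (T : ℝ), HasDerivWithinAt u (g (u t)) (Set.Icc 0 (T : ℝ)) t := by
  -- Speed at most `L` keeps the curve in the ball of radius `L * T`, so a Lipschitz constant on
  -- this compact convex set suffices for Picard–Lindelöf on all of `[0, T]`.
  obtain ⟨K, hK⟩ := hg.contDiffOn.exists_lipschitzOnWith (s := Metric.closedBall x₀ (L * T : ℝ≥0))
    one_ne_zero (convex_closedBall _ _) (isCompact_closedBall _ _)
  exact IsPicardLindelof.exists_eq_forall_mem_Icc_hasDerivWithinAt₀
    (t₀ := ⟨0, Set.left_mem_Icc.2 T.2⟩)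
    (IsPicardLindelof.of_time_independent (fun x _ => hL x) hK (by simp))

/-- A bounded continuous dissipative vector field has integral curves on every `[0, T]`. -/
theorem exists_integralCurve_Icc [FiniteDimensional ℝ E] {f : E → E} (hf : Continuous f)
    {M : ℝ} (hM : ∀ x, ‖f x‖ ≤ M) (hdis : ∀ x y, inner ℝ (x - y) (f x - f y) ≤ 0)
    (x₀ : E) (T : ℝ≥0) :
    ∃ u : ℝ → E, u 0 = x₀ ∧
      ∀ t ∈ Set.Icc 0 (T : ℝ), HasDerivWithinAt u (f (u t)) (Set.Icc 0 (T : ℝ)) t := by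
  have hM0 : 0 ≤ M := (norm_nonneg _).trans (hM x₀)
  have hT0 : (0 : ℝ) ≤ T := T.2
  lift M to ℝ≥0 using hM0
  set e : ℕ → ℝ := fun n => 1 / ((n : ℝ) + 1) with he
  have he0 : ∀ n, 0 < e n := fun n => by positivity
  have he1 : ∀ n, e n ≤ 1 := fun n => by
    rw [he]; simp only; rw [div_le_one (by positivity)]; linarith [n.cast_nonneg (α := ℝ)]
  have hetend : Filter.Tendsto e Filter.atTop (nhds 0) := tendsto_one_div_add_atTop_nhds_zero_nat
  choose g hgC hg using fun n => exists_contDiff_norm_sub_lt hf (he0 n)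
  set L : ℝ≥0 := M + 1 with hL
  have hgL : ∀ n x, ‖g n x‖ ≤ L := fun n x => by
    have h1 := norm_le_norm_add_norm_sub' (g n x) (f x)
    have h2 := hg n x
    have h3 := hM x
    have h4 := he1 n
    rw [hL]; push_cast; linarith
  choose u hu0 hu using fun n => exists_integralCurve_of_contDiff (hgC n) (hgL n) x₀ T
  have hlip : ∀ n, LipschitzOnWith L (u n) (Set.Icc 0 (T : ℝ)) := fun n =>
    (convex_Icc _ _).lipschitzOnWith_of_nnnorm_hasDerivWithin_le (hu n)
      (fun t _ => hgL n (u n t))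
  have h0mem : (0 : ℝ) ∈ Set.Icc (0 : ℝ) T := Set.left_mem_Icc.2 hT0
  have hball : ∀ n, ∀ t ∈ Set.Icc (0 : ℝ) T, ‖u n t - x₀‖ ≤ L * T := fun n t ht => by
    have := (hlip n).dist_le_mul t ht 0 h0mem
    rw [hu0, dist_eq_norm, Real.dist_eq, sub_zero, abs_of_nonneg ht.1] at this
    exact this.trans (mul_le_mul_of_nonneg_left ht.2 L.2)
  -- The contribution of `f` is nonpositive by dissipativity. What remains is the approximation
  -- error `e n + e m` times the distance, which is at most `2 * (L * T)`.
  have hdist : ∀ n m, ∀ t ∈ Set.Icc (0 : ℝ) T,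
      ‖u n t - u m t‖ ^ 2 ≤ (2 * (2 * (L * T) * (e n + e m))) * t := fun n m t ht => by
    refine norm_sub_sq_le (hu n) (hu m) (by rw [hu0, hu0]) (fun s hs => ?_) ht
    have h1 : g n (u n s) - g m (u m s) = (f (u n s) - f (u m s)) +
        ((g n (u n s) - f (u n s)) - (g m (u m s) - f (u m s))) := by abel
    have h2 : ‖u n s - u m s‖ ≤ 2 * (L * T) := by
      have := norm_sub_le (u n s - x₀) (u m s - x₀)
      rw [sub_sub_sub_cancel_right] at this
      linarith [hball n s hs, hball m s hs]
    have h3 : ‖(g n (u n s) - f (u n s)) - (g m (u m s) - f (u m s))‖ ≤ e n + e m :=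
      (norm_sub_le _ _).trans (add_le_add (hg _ _).le (hg _ _).le)
    have h4 := real_inner_le_norm (u n s - u m s)
      ((g n (u n s) - f (u n s)) - (g m (u m s) - f (u m s)))
    have h5 := mul_le_mul h2 h3 (norm_nonneg _) (by positivity)
    rw [h1, inner_add_right]
    linarith [hdis (u n s) (u m s)]
  have hcauchy : ∀ t ∈ Set.Icc (0 : ℝ) T, CauchySeq fun n => u n t := fun t ht => by
    refine cauchySeq_of_le_tendsto_0
      (fun N => √((2 * (2 * (L * T) * (e N + e N))) * T)) (fun n m N hn hm => ?_) ?_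
    · rw [dist_eq_norm]
      apply Real.le_sqrt_of_sq_le
      refine (hdist n m t ht).trans ?_
      have h1 : e n ≤ e N := one_div_le_one_div_of_le (by positivity) (by gcongr)
      have h2 : e m ≤ e N := one_div_le_one_div_of_le (by positivity) (by gcongr)
      have := ht.2
      have := ht.1
      have := (he0 n).le
      have := (he0 m).le
      have := (he0 N).le
      gcongr
    · have h : Filter.Tendsto (fun N => √((2 * (2 * (L * T) * (e N + e N))) * T))
          Filter.atTop (nhds (√((2 * (2 * (L * T) * (0 + 0))) * T))) :=
        Filter.Tendsto.sqrt ((((hetend.add hetend).const_mul _).const_mul _).mul_const _)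
      simpa using h
  have hlim : ∀ t, ∃ x, t ∈ Set.Icc (0 : ℝ) T →
      Filter.Tendsto (fun n => u n t) Filter.atTop (nhds x) := fun t => by
    by_cases ht : t ∈ Set.Icc (0 : ℝ) T
    · obtain ⟨x, hx⟩ := cauchySeq_tendsto_of_complete (hcauchy t ht)
      exact ⟨x, fun _ => hx⟩
    · exact ⟨0, fun h => absurd h ht⟩
  choose w hw using hlim
  have hwlip : LipschitzOnWith L w (Set.Icc 0 (T : ℝ)) :=
    LipschitzOnWith.of_dist_le_mul fun s hs t ht =>
      le_of_tendsto ((hw s hs).dist (hw t ht))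
        (Filter.Eventually.of_forall fun n => (hlip n).dist_le_mul s hs t ht)
  have hgw : ∀ t ∈ Set.Icc (0 : ℝ) T,
      Filter.Tendsto (fun n => g n (u n t)) Filter.atTop (nhds (f (w t))) := fun t ht => by
    have h1 := (hf.tendsto (w t)).comp (hw t ht)
    have h2 : Filter.Tendsto (fun n => g n (u n t) - f (u n t)) Filter.atTop (nhds 0) :=
      squeeze_zero_norm (fun n => (hg n (u n t)).le) hetend
    simpa using h2.add h1
  -- The limit is taken in the integral equation, by dominated convergence with the constant bound
  -- `L`; the derivatives themselves need not be passed to the limit.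
  have hint : ∀ t ∈ Set.Icc (0 : ℝ) T, w t = x₀ + ∫ s in (0 : ℝ)..t, f (w s) := fun t ht => by
    have hsub : Set.Icc 0 t ⊆ Set.Icc (0 : ℝ) T := Set.Icc_subset_Icc_right ht.2
    have hcont : ∀ n, ContinuousOn (fun s => g n (u n s)) (Set.Icc 0 t) := fun n =>
      (hgC n).continuous.comp_continuousOn ((hlip n).continuousOn.mono hsub)
    have h1 : ∀ n, u n t = x₀ + ∫ s in (0 : ℝ)..t, g n (u n s) := fun n => by
      rw [intervalIntegral.integral_eq_sub_of_hasDeriv_right_of_le ht.1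
        ((hlip n).continuousOn.mono hsub)
        (fun s hs => ((hu n s (hsub (Set.Ioo_subset_Icc_self hs))).hasDerivAt
          (Icc_mem_nhds hs.1 (hs.2.trans_le ht.2))).hasDerivWithinAt)
        ((hcont n).intervalIntegrable_of_Icc ht.1), hu0]
      abel
    have h2 : Filter.Tendsto (fun n => ∫ s in (0 : ℝ)..t, g n (u n s)) Filter.atTop
        (nhds (∫ s in (0 : ℝ)..t, f (w s))) := by
      refine intervalIntegral.tendsto_integral_filter_of_dominated_convergence (fun _ => (L : ℝ))
        (Filter.Eventually.of_forall fun n => ?_)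
        (Filter.Eventually.of_forall fun n => Filter.Eventually.of_forall fun s _ => hgL n _)
        intervalIntegrable_const (Filter.Eventually.of_forall fun s hs => ?_)
      · rw [Set.uIoc_of_le ht.1]
        exact ((hcont n).mono Set.Ioc_subset_Icc_self).aestronglyMeasurable measurableSet_Ioc
      · rw [Set.uIoc_of_le ht.1] at hs
        exact hgw s (hsub (Set.Ioc_subset_Icc_self hs))
    refine tendsto_nhds_unique (hw t ht) ?_
    simp_rw [h1]
    exact h2.const_add x₀
  have hfw : ContinuousOn (fun s => f (w s)) (Set.Icc 0 (T : ℝ)) :=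
    hf.comp_continuousOn hwlip.continuousOn
  refine ⟨w, by simpa using hint 0 h0mem, fun t ht => ?_⟩
  exact (ODE.hasDerivWithinAt_picard_Icc (f := fun _ => f) h0mem
    (u := Set.univ) (hf.comp_continuousOn continuousOn_snd) hwlip.continuousOn
    (fun _ _ => Set.mem_univ _) x₀ ht).congr_of_mem (fun s hs => hint s hs) ht

/-- A bounded continuous dissipative vector field has integral curves on `[0, ∞)`. -/
theorem exists_integralCurve_Ici [FiniteDimensional ℝ E] {f : E → E} (hf : Continuous f)
    {M : ℝ} (hM : ∀ x, ‖f x‖ ≤ M) (hdis : ∀ x y, inner ℝ (x - y) (f x - f y) ≤ 0) (x₀ : E) :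
    ∃ u : ℝ → E, u 0 = x₀ ∧
      ∀ t ∈ Set.Ici (0 : ℝ), HasDerivWithinAt u (f (u t)) (Set.Ici 0) t := by
  choose u hu0 hu using fun n : ℕ => exists_integralCurve_Icc hf hM hdis x₀ (n : ℝ≥0)
  simp only [NNReal.coe_natCast] at hu
  have hmono : ∀ n m : ℕ, n ≤ m → ∀ t ∈ Set.Icc (0 : ℝ) n, u n t = u m t := fun n m hnm t ht => by
    have hsub : Set.Icc (0 : ℝ) n ⊆ Set.Icc 0 m := Set.Icc_subset_Icc_right (by exact_mod_cast hnm)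
    exact eq_of_dissipative hdis (hu n) (fun s hs => (hu m s (hsub hs)).mono hsub)
      (by rw [hu0, hu0]) ht
  set w : ℝ → E := fun t => u ⌈t⌉₊ t with hwdef
  have hw : ∀ n : ℕ, ∀ t ∈ Set.Icc (0 : ℝ) n, w t = u n t := fun n t ht =>
    hmono _ n (Nat.ceil_le.2 ht.2) t ⟨ht.1, Nat.le_ceil t⟩
  refine ⟨w, by simp [hwdef, hu0], fun t ht => ?_⟩
  -- The extra `1` puts `t` strictly below the right end point, so the interval is a neighbourhood
  -- of `t` within `[0, ∞)`.
  have htn : t < ((⌈t⌉₊ + 1 : ℕ) : ℝ) := by push_cast; linarith [Nat.le_ceil t]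
  have hmem : t ∈ Set.Icc (0 : ℝ) ((⌈t⌉₊ + 1 : ℕ) : ℝ) := ⟨ht, htn.le⟩
  have h1 := (hu _ t hmem).congr_of_mem (fun s hs => hw _ s hs) hmem
  rw [← hw _ t hmem] at h1
  refine h1.mono_of_mem_nhdsWithin ?_
  rw [← Set.Ici_inter_Iic]
  exact Filter.inter_mem self_mem_nhdsWithin (mem_nhdsWithin_of_mem_nhds (Iic_mem_nhds htn))

end Dissipative

/-! ### A monotonicity criterion -/

/-- A continuous function which is differentiable with nonpositive derivative wherever it avoids
finitely many values is antitone. -/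
theorem antitone_of_hasDerivAt_nonpos_off_finite {φ : ℝ → ℝ} (hφ : Continuous φ) {Z : Set ℝ}
    (hZ : Z.Finite) (h : ∀ t, φ t ∉ Z → ∃ d ≤ 0, HasDerivAt φ d t) : Antitone φ := by
  intro a b hab
  by_contra! hlt
  have hopen : IsOpen (Set.Ioo (φ a) (φ b) \ Z) := isOpen_Ioo.sdiff hZ.isClosed
  obtain ⟨c, hc⟩ : (Set.Ioo (φ a) (φ b) \ Z).Nonempty :=
    ((Set.Ioo_infinite hlt).sdiff hZ).nonempty
  obtain ⟨δ, hδ, hball⟩ := Metric.isOpen_iff.1 hopen c hc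
  have hmem : ∀ y, c - δ < y → y < c + δ → y ∈ Set.Ioo (φ a) (φ b) \ Z := fun y h1 h2 =>
    hball (by rw [Real.ball_eq_Ioo]; exact ⟨h1, h2⟩)
  -- A smooth step whose rise lies in a gap between the values in `Z`. Near a time with `φ t ∈ Z`
  -- the composite `P ∘ φ` is locally constant, so it is differentiable with derivative `≤ 0`
  -- everywhere; yet it would rise from `0` at `a` to `1` at `b`.
  set P : ℝ → ℝ := fun y => Real.smoothTransition ((y - c) / (δ / 2)) with hP
  have hPm : Monotone P := fun x y hxy => Real.smoothTransition.monotone (by gcongr)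
  have hPd : Differentiable ℝ P := by
    have := (Real.smoothTransition.contDiff (n := 1)).differentiable one_ne_zero
    exact this.comp (by fun_prop)
  have hP0 : ∀ y ≤ c, P y = 0 := fun y hy =>
    Real.smoothTransition.zero_of_nonpos (div_nonpos_of_nonpos_of_nonneg (by linarith) (by linarith))
  have hP1 : ∀ y, c + δ / 2 ≤ y → P y = 1 := fun y hy =>
    Real.smoothTransition.one_of_one_le (by rw [le_div_iff₀ (by linarith)]; linarith)
  have hd : ∀ t, ∃ d ≤ 0, HasDerivAt (P ∘ φ) d t := fun t => by
    by_cases ht : φ t ∈ Z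
    · refine ⟨0, le_rfl, ?_⟩
      rcases lt_or_ge (φ t) c with h1 | h1
      · refine (hasDerivAt_const t (0 : ℝ)).congr_of_eventuallyEq ?_
        filter_upwards [hφ.continuousAt.eventually (Iio_mem_nhds h1)] with s hs
        exact hP0 _ (le_of_lt hs)
      · have h2 : c + δ / 2 < φ t := by
          by_contra! h2
          exact (hmem (φ t) (by linarith) (by linarith)).2 ht
        refine (hasDerivAt_const t (1 : ℝ)).congr_of_eventuallyEq ?_
        filter_upwards [hφ.continuousAt.eventually (Ioi_mem_nhds h2)] with s hs
        exact hP1 _ (le_of_lt hs)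
    · obtain ⟨d, hd0, hd⟩ := h t ht
      exact ⟨deriv P (φ t) * d, mul_nonpos_of_nonneg_of_nonpos hPm.deriv_nonneg hd0,
        (hPd (φ t)).hasDerivAt.comp t hd⟩
  have hanti : Antitone (P ∘ φ) := antitone_of_deriv_nonpos
    (fun t => (hd t).choose_spec.2.differentiableAt)
    (fun t => by obtain ⟨d, h0, h1⟩ := hd t; rwa [h1.deriv])
  have h1 := hanti hab
  have ha := (hmem (c - δ / 2) (by linarith) (by linarith)).1.1
  have hb := (hmem (c + δ / 2) (by linarith) (by linarith)).1.2
  simp only [Function.comp] at h1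
  rw [hP1 _ hb.le, hP0 _ (by linarith [hc.1.1])] at h1
  norm_num at h1

end RicciFlow

namespace RicciFlow

namespace TriangulatedSurface

variable {F : Type*} [Fintype F] (S : TriangulatedSurface F)

/-! ### Monotonicity of the extended curvature -/

/-- The square of the length of an oriented side. -/
noncomputable def sqLength (ε : S.Vertex → ℝ) (η : S.Edge → ℝ) (u : S.Vertex → ℝ)
    (d : Dart F) : ℝ :=
  ε (S.vertex d.tail) * Real.exp (2 * u (S.vertex d.tail))
    + ε (S.vertex d.head) * Real.exp (2 * u (S.vertex d.head))
    + 2 * η (S.edge d) * Real.exp (u (S.vertex d.tail) + u (S.vertex d.head))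

variable {S} {ε : S.Vertex → ℝ} {η : S.Edge → ℝ}

theorem length_eq_sqrt (u : S.Vertex → ℝ) (d : Dart F) :
    S.length ε η u d = √(S.sqLength ε η u d) := rfl

theorem edge_rev (d : Dart F) : S.edge d.rev = S.edge d :=
  (Quot.sound (r := fun d d' : Dart F => d' = d.rev ∨ d' = S.glue d) (Or.inl rfl)).symm

theorem edge_side_comm (σ : F) {a b : Fin 3} (h : a ≠ b) :
    S.edge (side σ b a h.symm) = S.edge (side σ a b h) :=
  edge_rev (side σ a b h)

theorem sqLength_rev (u : S.Vertex → ℝ) (d : Dart F) :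
    S.sqLength ε η u d.rev = S.sqLength ε η u d := by
  unfold sqLength
  rw [edge_rev]
  change ε (S.vertex d.head) * _ + ε (S.vertex d.tail) * _ + _ *
    Real.exp (u (S.vertex d.head) + u (S.vertex d.tail)) = _
  rw [add_comm (u (S.vertex d.head))]
  simp only [Dart.head, Dart.tail, Dart.rev]
  ring

/-- Because `ε i ^ 2 = ε i`, the squared lengths are polynomials in `s i = ε i * exp (u i)` and the
rescaled edge weights, the form used in `angle_variation_nonpos`. -/
theorem sqLength_eq (hε : ∀ i, ε i = 0 ∨ ε i = 1) (u : S.Vertex → ℝ) (d : Dart F) :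
    S.sqLength ε η u d =
      (ε (S.vertex d.tail) * Real.exp (u (S.vertex d.tail))) ^ 2
      + (ε (S.vertex d.head) * Real.exp (u (S.vertex d.head))) ^ 2
      + 2 * (η (S.edge d) * Real.exp (u (S.vertex d.tail) + u (S.vertex d.head))) := by
  have hsq : ∀ i, ε i ^ 2 = ε i := fun i => by rcases hε i with h | h <;> rw [h] <;> norm_num
  have hexp : ∀ y : ℝ, Real.exp (2 * y) = Real.exp y ^ 2 := fun y => by
    rw [← Real.exp_nat_mul]; norm_num
  unfold sqLength
  rw [mul_pow, mul_pow, hsq, hsq, hexp, hexp]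
  ring

theorem mul_exp_add_pos (h1 : S.StructureCondition1 ε η) (u : S.Vertex → ℝ) (d : Dart F) :
    0 < (ε (S.vertex d.tail) * Real.exp (u (S.vertex d.tail)))
        * (ε (S.vertex d.head) * Real.exp (u (S.vertex d.head)))
      + η (S.edge d) * Real.exp (u (S.vertex d.tail) + u (S.vertex d.head)) := by
  have := mul_pos (h1 d) (Real.exp_pos (u (S.vertex d.tail) + u (S.vertex d.head)))
  rw [Real.exp_add] at this ⊢
  linarith

/-- With `s`, `t` the end-point terms and `b` the edge term, `s² + t² + 2b = (s - t)² + 2(st + b)`.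
Lengths are thus always positive, and only the triangle inequalities can fail. -/
theorem sqLength_pos (hε : ∀ i, ε i = 0 ∨ ε i = 1) (h1 : S.StructureCondition1 ε η)
    (u : S.Vertex → ℝ) (d : Dart F) : 0 < S.sqLength ε η u d := by
  rw [sqLength_eq hε]
  have := mul_exp_add_pos h1 u d
  nlinarith [sq_nonneg (ε (S.vertex d.tail) * Real.exp (u (S.vertex d.tail))
    - ε (S.vertex d.head) * Real.exp (u (S.vertex d.head)))]

theorem continuous_sqLength (d : Dart F) : Continuous fun u => S.sqLength ε η u d := by
  unfold sqLength
  fun_prop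

/-- The condition is homogeneous: multiply it by `exp (2 u_q + u_s + u_t)` and replace `ε` by `ε ^
2`. -/
theorem structure_condition_exp (hε : ∀ i, ε i = 0 ∨ ε i = 1)
    (h2 : S.StructureCondition2 ε η) (u : S.Vertex → ℝ) (σ : F)
    {q s t : Fin 3} (hqs : q ≠ s) (htq : t ≠ q) (hst : s ≠ t) :
    0 ≤ (ε (S.vertex (σ, q)) * Real.exp (u (S.vertex (σ, q)))) ^ 2
        * (η (S.edge (side σ s t hst)) * Real.exp (u (S.vertex (σ, s)) + u (S.vertex (σ, t))))
      + η (S.edge (side σ t q htq)) * Real.exp (u (S.vertex (σ, t)) + u (S.vertex (σ, q)))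
        * (η (S.edge (side σ q s hqs)) * Real.exp (u (S.vertex (σ, q)) + u (S.vertex (σ, s)))) := by
  have hsq : ∀ i, ε i ^ 2 = ε i := fun i => by rcases hε i with h | h <;> rw [h] <;> norm_num
  have h := h2 σ q s t hqs htq.symm hst
  rw [edge_side_comm σ htq] at h
  have h' := mul_nonneg h (mul_pos (pow_pos (Real.exp_pos (u (S.vertex (σ, q)))) 2)
    (Real.exp_pos (u (S.vertex (σ, s)) + u (S.vertex (σ, t))))).le
  rw [mul_pow, hsq]
  simp only [Real.exp_add] at h' ⊢
  linarith

/-- The weighted sum of the angles of a face. -/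
theorem sum_mul_cornerAngle (hε : ∀ i, ε i = 0 ∨ ε i = 1) (h1 : S.StructureCondition1 ε η)
    (u : S.Vertex → ℝ) (σ : F) (x : Fin 3 → ℝ) :
    ∑ i, x i * S.cornerAngle ε η u (σ, i) = angleSum (x 0) (x 1) (x 2)
      (S.sqLength ε η u (side σ 1 2 (by decide))) (S.sqLength ε η u (side σ 2 0 (by decide)))
      (S.sqLength ε η u (side σ 0 1 (by decide))) := by
  have hpos := fun d => Real.sqrt_pos.2 (sqLength_pos hε h1 u d)
  have hrev : ∀ (a b : Fin 3) (h : a ≠ b), S.sqLength ε η u (side σ b a h.symm) =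
      S.sqLength ε η u (side σ a b h) := fun a b h => sqLength_rev u (side σ a b h)
  rw [Fin.sum_univ_three, angleSum]
  congr 1
  · congr 1
    · congr 1
      rw [extAngle_comm (hpos _) (hpos _) (hpos _), hrev 0 2 (by decide)]
      rfl
    · congr 1
      rw [extAngle_comm (hpos _) (hpos _) (hpos _), hrev 1 0 (by decide)]
      rfl
  · congr 1
    rw [extAngle_comm (hpos _) (hpos _) (hpos _), hrev 2 1 (by decide)]
    rfl

/-- The `arccos` formula holds for degenerate triangles too, and its denominator never vanishes, so
no separate argument is needed at the boundary of degeneracy. -/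
theorem continuous_cornerAngle (hε : ∀ i, ε i = 0 ∨ ε i = 1) (h1 : S.StructureCondition1 ε η)
    (c : F × Fin 3) : Continuous fun u => S.cornerAngle ε η u c := by
  unfold cornerAngle
  simp only [length_eq_sqrt, extAngle_sqrt (sqLength_pos hε h1 _ _) (sqLength_pos hε h1 _ _)
    (sqLength_pos hε h1 _ _)]
  refine Real.continuous_arccos.comp (Continuous.div ?_ ?_ fun u => ?_)
  · exact ((continuous_sqLength _).add (continuous_sqLength _)).sub (continuous_sqLength _)
  · exact (continuous_const.mul (continuous_sqLength _).sqrt).mul (continuous_sqLength _).sqrt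
  · have := Real.sqrt_pos.2 (sqLength_pos hε h1 u (side c.1 c.2 (c.2 + 1) (by simp)))
    have := Real.sqrt_pos.2 (sqLength_pos hε h1 u (side c.1 c.2 (c.2 + 2) (by simp)))
    positivity

theorem hasDerivAt_sqLength (hε : ∀ i, ε i = 0 ∨ ε i = 1) (u w : S.Vertex → ℝ)
    (d : Dart F) (t : ℝ) :
    HasDerivAt (fun t : ℝ => S.sqLength ε η (fun i => u i + t * w i) d)
      (2 * ((ε (S.vertex d.tail) * Real.exp (u (S.vertex d.tail) + t * w (S.vertex d.tail))) ^ 2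
          * w (S.vertex d.tail)
        + (ε (S.vertex d.head) * Real.exp (u (S.vertex d.head) + t * w (S.vertex d.head))) ^ 2
          * w (S.vertex d.head)
        + (w (S.vertex d.tail) + w (S.vertex d.head)) * (η (S.edge d)
          * Real.exp ((u (S.vertex d.tail) + t * w (S.vertex d.tail))
            + (u (S.vertex d.head) + t * w (S.vertex d.head)))))) t := by
  simp only [sqLength_eq hε]
  have hlin : ∀ i, HasDerivAt (fun t : ℝ => u i + t * w i) (w i) t := fun i => by
    simpa using ((hasDerivAt_id t).mul_const (w i)).const_add (u i)
  refine ((((hlin (S.vertex d.tail)).exp.const_mul (ε (S.vertex d.tail))).pow 2).add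
    (((hlin (S.vertex d.head)).exp.const_mul (ε (S.vertex d.head))).pow 2) |>.add
    ((((hlin (S.vertex d.tail)).add (hlin (S.vertex d.head))).exp.const_mul
      (η (S.edge d))).const_mul 2)).congr_deriv ?_
  simp only [Pi.add_apply]
  ring

/-- In the direction of the weights, the weighted sum of the angles of a face is decreasing. -/
theorem antitone_sum_mul_cornerAngle (hε : ∀ i, ε i = 0 ∨ ε i = 1)
    (h1 : S.StructureCondition1 ε η) (h2 : S.StructureCondition2 ε η)
    (u w : S.Vertex → ℝ) (σ : F) :
    Antitone fun t : ℝ => ∑ i, w (S.vertex (σ, i)) *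
      S.cornerAngle ε η (fun j => u j + t * w j) (σ, i) := by
  refine antitone_of_hasDerivAt_nonpos_off_finite
    (Z := {w (S.vertex (σ, 0)) * Real.pi, w (S.vertex (σ, 1)) * Real.pi,
      w (S.vertex (σ, 2)) * Real.pi}) ?_ (by simp) fun t ht => ?_
  · refine continuous_finsetSum _ fun i _ => continuous_const.mul ?_
    exact (continuous_cornerAngle hε h1 (σ, i)).comp (by fun_prop)
  have hpos := fun d (s : ℝ) => sqLength_pos hε h1 (fun j => u j + s * w j) d
  simp only [sum_mul_cornerAngle hε h1 _ σ (fun i => w (S.vertex (σ, i)))] at ht ⊢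
  have hD := heron_pos_of_angleSum_notMem (hpos _ t) (hpos _ t) (hpos _ t) ht
  have hA := hasDerivAt_sqLength (η := η) hε u w (side σ 1 2 (by decide)) t
  have hB := hasDerivAt_sqLength (η := η) hε u w (side σ 2 0 (by decide)) t
  have hC := hasDerivAt_sqLength (η := η) hε u w (side σ 0 1 (by decide)) t
  have hcyc : ∀ A B C : ℝ, heron B C A = heron A B C := fun A B C => by unfold heron; ring
  have d1 := hasDerivAt_extAngle hA hB hC (hpos _) (hpos _) (hpos _) hD
  have d2 := hasDerivAt_extAngle hB hC hA (hpos _) (hpos _) (hpos _) (by rwa [hcyc])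
  have d3 := hasDerivAt_extAngle hC hA hB (hpos _) (hpos _) (hpos _) (by rwa [← hcyc])
  rw [hcyc] at d2
  rw [← hcyc] at d3
  refine ⟨_, ?_, ((d1.const_mul (w (S.vertex (σ, 0)))).add
    (d2.const_mul (w (S.vertex (σ, 1))))).add (d3.const_mul (w (S.vertex (σ, 2))))⟩
  rw [← mul_div_assoc, ← mul_div_assoc, ← mul_div_assoc, ← add_div, ← add_div]
  refine div_nonpos_of_nonpos_of_nonneg ?_ (Real.sqrt_nonneg _)
  -- The three weights are arbitrary reals here, so corners of the face that are identified in the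
  -- surface cause no difficulty.
  exact angle_variation_nonpos
    (mul_exp_add_pos h1 (fun j => u j + t * w j) (side σ 1 2 (by decide)))
    (mul_exp_add_pos h1 (fun j => u j + t * w j) (side σ 2 0 (by decide)))
    (mul_exp_add_pos h1 (fun j => u j + t * w j) (side σ 0 1 (by decide)))
    (structure_condition_exp hε h2 (fun j => u j + t * w j) σ (q := 0) (s := 1) (t := 2)
      (by decide) (by decide) (by decide))
    (structure_condition_exp hε h2 (fun j => u j + t * w j) σ (q := 1) (s := 2) (t := 0)
      (by decide) (by decide) (by decide))
    (structure_condition_exp hε h2 (fun j => u j + t * w j) σ (q := 2) (s := 0) (t := 1)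
      (by decide) (by decide) (by decide))
    (sqLength_eq hε _ _) (sqLength_eq hε _ _) (sqLength_eq hε _ _) rfl rfl rfl hD

/-- Regrouping the corners by face instead of by vertex reduces monotonicity to a single triangle.
-/
theorem sum_mul_extCurvature (u w : S.Vertex → ℝ) :
    ∑ i, w i * S.extCurvature ε η u i =
      ∑ i, w i * (2 * Real.pi) - ∑ σ, ∑ a, w (S.vertex (σ, a)) * S.cornerAngle ε η u (σ, a) := by
  classical
  rw [← Fintype.sum_prod_type' (f := fun σ a => w (S.vertex (σ, a)) * S.cornerAngle ε η u (σ, a))]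
  simp only [extCurvature, mul_sub, Finset.sum_sub_distrib, Finset.mul_sum]
  congr 1
  rw [Finset.sum_comm]
  refine Finset.sum_congr rfl fun c _ => ?_
  simp [mul_ite, Finset.sum_ite_eq]

/-- The extended curvature is a monotone operator. -/
theorem sum_mul_extCurvature_sub_nonneg (hε : ∀ i, ε i = 0 ∨ ε i = 1)
    (h1 : S.StructureCondition1 ε η) (h2 : S.StructureCondition2 ε η) (u v : S.Vertex → ℝ) :
    0 ≤ ∑ i, (v i - u i) * (S.extCurvature ε η v i - S.extCurvature ε η u i) := by
  have hv : (fun j => u j + 1 * (v j - u j)) = v := by ext j; ring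
  have hu : (fun j => u j + 0 * (v j - u j)) = u := by ext j; ring
  -- The face estimate along the segment from `u` to `v`, with weights equal to its direction,
  -- compared at `t = 0` and `t = 1`.
  have hface := Finset.sum_le_sum fun (σ : F) (_ : σ ∈ Finset.univ) =>
    antitone_sum_mul_cornerAngle hε h1 h2 u (fun i => v i - u i) σ zero_le_one
  simp only [hu, hv] at hface
  have e1 := sum_mul_extCurvature (ε := ε) (η := η) v (fun i => v i - u i)
  have e2 := sum_mul_extCurvature (ε := ε) (η := η) u (fun i => v i - u i)
  simp only [mul_sub (_ - _) (S.extCurvature ε η v _), Finset.sum_sub_distrib]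
  linarith

theorem continuous_extCurvature (hε : ∀ i, ε i = 0 ∨ ε i = 1) (h1 : S.StructureCondition1 ε η)
    (i : S.Vertex) : Continuous fun u => S.extCurvature ε η u i := by
  unfold extCurvature
  refine continuous_const.sub (continuous_finsetSum _ fun c _ => ?_)
  split_ifs
  · exact continuous_cornerAngle hε h1 c
  · exact continuous_const

theorem abs_cornerAngle_le (u : S.Vertex → ℝ) (c : F × Fin 3) :
    |S.cornerAngle ε η u c| ≤ Real.pi := by
  unfold cornerAngle extAngle
  split_ifs
  · rw [abs_of_nonneg (Real.arccos_nonneg _)]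
    exact Real.arccos_le_pi _
  · rw [abs_of_nonneg Real.pi_pos.le]
  · simpa using Real.pi_pos.le

theorem abs_extCurvature_le (u : S.Vertex → ℝ) (i : S.Vertex) :
    |S.extCurvature ε η u i| ≤ 2 * Real.pi + ∑ _c : F × Fin 3, Real.pi := by
  unfold extCurvature
  refine (abs_sub _ _).trans (add_le_add (abs_of_pos Real.two_pi_pos).le
    ((Finset.abs_sum_le_sum_abs _ _).trans (Finset.sum_le_sum fun c _ => ?_)))
  split_ifs
  · exact abs_cornerAngle_le u c
  · simpa using Real.pi_pos.le

/-! ### The flow -/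

variable (S) in
/-- The vector field of the flow, on the Euclidean space of discrete conformal factors. -/
noncomputable def flowField (ε : S.Vertex → ℝ) (η : S.Edge → ℝ) (Kbar : S.Vertex → ℝ)
    (x : EuclideanSpace ℝ S.Vertex) : EuclideanSpace ℝ S.Vertex :=
  WithLp.toLp 2 fun i => Kbar i - S.extCurvature ε η x.ofLp i

theorem flowField_dissipative (hε : ∀ i, ε i = 0 ∨ ε i = 1)
    (h1 : S.StructureCondition1 ε η) (h2 : S.StructureCondition2 ε η) (Kbar : S.Vertex → ℝ)
    (x y : EuclideanSpace ℝ S.Vertex) :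
    inner ℝ (x - y) (S.flowField ε η Kbar x - S.flowField ε η Kbar y) ≤ 0 := by
  have h := sum_mul_extCurvature_sub_nonneg hε h1 h2 y.ofLp x.ofLp
  have e : inner ℝ (x - y) (S.flowField ε η Kbar x - S.flowField ε η Kbar y) =
      -∑ i, (x i - y i) * (S.extCurvature ε η x.ofLp i - S.extCurvature ε η y.ofLp i) := by
    rw [PiLp.inner_apply, ← Finset.sum_neg_distrib]
    refine Finset.sum_congr rfl fun i _ => ?_
    simp only [flowField, PiLp.sub_apply, RCLike.inner_apply, conj_trivial]
    ring
  rw [e]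
  linarith

theorem continuous_flowField (hε : ∀ i, ε i = 0 ∨ ε i = 1) (h1 : S.StructureCondition1 ε η)
    (Kbar : S.Vertex → ℝ) : Continuous (S.flowField ε η Kbar) := by
  refine (PiLp.continuous_toLp 2 _).comp (continuous_pi fun i => continuous_const.sub ?_)
  exact (continuous_extCurvature hε h1 i).comp (PiLp.continuous_ofLp 2 _)

theorem norm_flowField_le (Kbar : S.Vertex → ℝ) (x : EuclideanSpace ℝ S.Vertex) :
    ‖S.flowField ε η Kbar x‖ ≤
      √(∑ i, (|Kbar i| + (2 * Real.pi + ∑ _c : F × Fin 3, Real.pi)) ^ 2) := by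
  rw [EuclideanSpace.norm_eq]
  refine Real.sqrt_le_sqrt (Finset.sum_le_sum fun i _ => ?_)
  gcongr
  exact (abs_sub _ _).trans (add_le_add le_rfl (abs_extCurvature_le _ _))

/-- Dissipativity needs an inner product, so the componentwise equations are moved from the product
space to `EuclideanSpace`. -/
theorem isSolutionOn_iff {Kbar : S.Vertex → ℝ} {J : Set ℝ} {u : ℝ → S.Vertex → ℝ} :
    S.IsSolutionOn ε η Kbar J u ↔ ∀ t ∈ J, HasDerivWithinAt (fun s => WithLp.toLp 2 (u s))
      (S.flowField ε η Kbar (WithLp.toLp 2 (u t))) J t := by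
  refine forall₂_congr fun t _ => ?_
  rw [← hasDerivWithinAt_pi (φ := u) (φ' := fun i => Kbar i - S.extCurvature ε η (u t) i)]
  constructor
  · intro h
    exact (PiLp.continuousLinearEquiv 2 ℝ
      (fun _ : S.Vertex => ℝ)).symm.hasFDerivAt.comp_hasDerivWithinAt t h
  · intro h
    exact (PiLp.continuousLinearEquiv 2 ℝ
      (fun _ : S.Vertex => ℝ)).hasFDerivAt.comp_hasDerivWithinAt t h

end TriangulatedSurface

end RicciFlow

open RicciFlow RicciFlow.TriangulatedSurface in
theorem theorem2p11 {F : Type*} [Fintype F] (S : RicciFlow.TriangulatedSurface F)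
    (ε : S.Vertex → ℝ) (η : S.Edge → ℝ)
    (hε : ∀ i, ε i = 0 ∨ ε i = 1)
    (h1 : S.StructureCondition1 ε η) (h2 : S.StructureCondition2 ε η)
    (Kbar : S.Vertex → ℝ) (hKlt : ∀ i, Kbar i < 2 * Real.pi)
    (hKsum : ∑ i, Kbar i = 2 * Real.pi * (S.eulerChar : ℝ))
    (u₀ : S.Vertex → ℝ) :
    (∃ u : ℝ → S.Vertex → ℝ, S.IsSolutionOn ε η Kbar (Set.Ici 0) u ∧ u 0 = u₀) ∧
    (∀ J : Set ℝ, J.OrdConnected → 0 ∈ J → J ⊆ Set.Ici 0 →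
      ∀ u v : ℝ → S.Vertex → ℝ,
        S.IsSolutionOn ε η Kbar J u → u 0 = u₀ →
        S.IsSolutionOn ε η Kbar J v → v 0 = u₀ →
        ∀ t ∈ J, u t = v t) := by
  constructor
  · obtain ⟨u, hu0, hu⟩ := exists_integralCurve_Ici (continuous_flowField hε h1 Kbar)
      (norm_flowField_le Kbar) (flowField_dissipative hε h1 h2 Kbar) (WithLp.toLp 2 u₀)
    exact ⟨fun t => (u t).ofLp, isSolutionOn_iff.2 hu, by simp [hu0]⟩
  · intro J hJ h0 hJ0 u v hu hu0 hv hv0 t ht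
    -- Order-connectedness reduces uniqueness on `J` to the compact interval `[0, t]`.
    have hsub : Set.Icc 0 t ⊆ J := hJ.out h0 ht
    exact WithLp.toLp_injective 2 (eq_of_dissipative (flowField_dissipative hε h1 h2 Kbar)
      (fun s hs => (isSolutionOn_iff.1 hu s (hsub hs)).mono hsub)
      (fun s hs => (isSolutionOn_iff.1 hv s (hsub hs)).mono hsub)
      (by rw [hu0, hv0]) ⟨hJ0 ht, le_rfl⟩)
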